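/- Let $Y_1,\dots,Y_q$ be locally Lipschitz vector fields on $\mathbb{R}^n$. For $x\in\mathbb{R}^n$ and $r>0$ let $P_x^r:=\{\sum_{j=1}^q c_jY_j(x): c\in\mathbb{R}^q,\ |c|\le r\}$, and assume that for every bounded open set $U\subset\mathbb{R}^n$ there is $C_U>0$ such that for all $j,k$ $$[Y_j,Y_k](x):=DY_k(x)Y_j(x)-DY_j(x)Y_k(x)\in P_x^{C_U}\quad\text{for a.e. }x\in U$$ (the derivatives exist almost everywhere by Rademacher's theorem). A path $\gamma:[0,T]\to\mathbb{R}^n$ $(T\ge 0)$ is called subunit if it is Lipschitz and there is $u\in L^\infty((0,T),\mathbb{R}^q)$ with $|u(t)|\le 1$ and $\dot\gamma(t)=\sum_{j=1}^q u_j(t)Y_j(\gamma(t))$ for a.e. $t\in(0,T)$. For $p\ge1$ let $\mathcal I(p,m)$ be the set of multi-indices $(i_1,\dots,i_p)$ with $1\le i_1<\dots<i_p\le m$. For $J\in\mathcal I(p,q)$ put $Y_J(x):=Y_{j_1}(x)\wedge\dots\wedge Y_{j_p}(x)\in\bigwedge^p\mathbb{R}^n$, and for $K\in\mathcal I(p,n)$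 let $Y_J^K(x)$ be the $p\times p$ minor with rows $k_1,\dots,k_p$ of the matrix with columns $Y_{j_1}(x),\dots,Y_{j_p}(x)$. Let $\Lambda_p(x):=(Y_J^K(x))_{J\in\mathcal I(p,q),\,K\in\mathcal I(p,n)}$. All norms are Euclidean; on $\bigwedge^p\mathbb{R}^n$ the vectors $e_{k_1}\wedge\dots\wedge e_{k_p}$, $K\in\mathcal I(p,n)$, are orthonormal (if $p>n$, then $\bigwedge^p\mathbb{R}^n=0$ and $|\Lambda_p|=0$). **Theorem.** Let $\Omega\subset\mathbb{R}^n$ be a bounded set. Then there is $C>0$ such that for every $x\in\Omega$, every $T\ge 0$ and every subunit path $\gamma:[0,T]\to\mathbb{R}^n$ with $\gamma(0)=x$: 1. for every $p\in\{1,\dots,\min\{q,n\}\}$, $$|\Lambda_p(\gamma(t))-\Lambda_p(x)|\le|\Lambda_p(x)|\,(e^{Ct}-1)\quad\text{for all }t\in[0,C^{-1}]\cap[0,T];$$ 2. for every $p\in\{1,\dots,q\}$ and every $I\in\mathcal I(p,q)$, $$|Y_I(\gamma(t))-Y_I(x)|\le C\,|\Lambda_p(x)|\,(e^{Ct}-1)\quad\text{for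 all }t\in[0,C^{-1}]\cap[0,T].$$ -/

import Mathlib

open MeasureTheory

namespace LipDistribution

/-- Vectors of `ℝⁿ`, with the Euclidean norm. -/
abbrev E (n : ℕ) : Type := EuclideanSpace ℝ (Fin n)

/-- Strictly increasing multi-indices `1 ≤ i₁ < ⋯ < i_p ≤ m` (with values in `Fin m`). -/
abbrev MultiIndex (p m : ℕ) : Type := Fin p ↪o Fin m

noncomputable instance instFintypeMultiIndex (p m : ℕ) : Fintype (MultiIndex p m) :=
  Fintype.ofInjective (fun I : MultiIndex p m => (I : Fin p → Fin m)) DFunLike.coe_injective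

/-- The set `P_x^r = {∑ⱼ cⱼ Yⱼ(x) : |c| ≤ r}`, where `|c|` is the Euclidean norm. -/
def ballSpan {n q : ℕ} (Y : Fin q → E n → E n) (r : ℝ) (x : E n) : Set (E n) :=
  {v | ∃ c : E q, ‖c‖ ≤ r ∧ v = ∑ j, c j • Y j x}

/-- Quantitative involutivity: on each bounded open set `Ω` there is a constant `C` such that
`[Yⱼ, Yₖ]_x ∈ P_x^C` for all `j, k` and a.e. `x ∈ Ω`. For locally Lipschitz fields the bracket
`DYₖ(x) Yⱼ(x) - DYⱼ(x) Yₖ(x)` makes sense at a.e. `x`. -/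
def AEInvolutive {n q : ℕ} (Y : Fin q → E n → E n) : Prop :=
  ∀ Ω : Set (E n), IsOpen Ω → Bornology.IsBounded Ω → ∃ C : ℝ, 0 < C ∧ ∀ j k : Fin q,
    ∀ᵐ x ∂(volume.restrict Ω), VectorField.lieBracket ℝ (Y j) (Y k) x ∈ ballSpan Y C x

/-- `γ` is subunit on `[0, T]`: it is Lipschitz there and, for some `u ∈ L^∞((0, T), ℝ^q)` with
`|u| ≤ 1` a.e., satisfies `γ'(t) = ∑ⱼ uⱼ(t) Yⱼ(γ(t))` for a.e. `t ∈ (0, T)`. -/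
def IsSubunit {n q : ℕ} (Y : Fin q → E n → E n) (T : ℝ) (γ : ℝ → E n) : Prop :=
  (∃ L, LipschitzOnWith L γ (Set.Icc 0 T)) ∧
  ∃ u : ℝ → E q, MemLp u ⊤ (volume.restrict (Set.Ioo 0 T)) ∧
    ∀ᵐ t ∂(volume.restrict (Set.Ioo 0 T)),
      ‖u t‖ ≤ 1 ∧ HasDerivAt γ (∑ j, u t j • Y j (γ t)) t

/-- The minor `Y_J^K(x)`: the determinant with entry `g_{j_a}^{k_b}(x)` in row `b`, column `a`. -/
noncomputable def minor {n q p : ℕ} (Y : Fin q → E n → E n) (J : MultiIndex p q)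
    (K : MultiIndex p n) (x : E n) : ℝ :=
  (Matrix.of fun b a : Fin p => Y (J a) x (K b)).det

/-- `Λ_p(x)`: the vector of all `p × p` minors `Y_J^K(x)`, with the Euclidean norm. -/
noncomputable def minorVector {n q : ℕ} (Y : Fin q → E n → E n) (p : ℕ) (x : E n) :
    EuclideanSpace ℝ (MultiIndex p q × MultiIndex p n) :=
  WithLp.toLp 2 fun JK => minor Y JK.1 JK.2 x

/-- `Y_I(x) = Y_{i₁}(x) ∧ ⋯ ∧ Y_{i_p}(x)` in `⋀ᵖ ℝⁿ`, which carries the Euclidean norm for which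
the `e_{k₁} ∧ ⋯ ∧ e_{k_p}`, `k₁ < ⋯ < k_p`, are orthonormal. -/
noncomputable def wedge {n q p : ℕ} (Y : Fin q → E n → E n) (I : MultiIndex p q) (x : E n) :
    ⋀[ℝ]^p (E n) :=
  exteriorPower.ιMulti ℝ p fun a => Y (I a) x

end LipDistribution

/-!
For smooth fields the estimates come from Grönwall's inequality.  Along a subunit path,
`Yⱼ(γ)' = ∑ₗ uₗ DYⱼ Yₗ = A Yⱼ + ∑ₗ uₗ [Yₗ, Yⱼ]` with `A = ∑ₗ uₗ DYₗ`, and the brackets are bounded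
combinations of the fields.  By Jacobi's formula the derivative of a minor `Y_J^K` then splits into
two parts: the linear map `A` recombines the rows and the brackets recombine the columns of the
matrix of coordinates, so that both parts are bounded combinations of minors of the same size.
Hence `|Λ_p(γ)'| ≤ C |Λ_p(γ)|` (`norm_minorVectorDeriv_le`), and Grönwall applies.

For Lipschitz fields the derivatives and the bracket condition are available only almost everywhere,
and the path may lie entirely in the exceptional null set.  The remedy is to translate the path: by
Fubini, for almost every small `h` the curve `γ + h` meets the null set only for a null set of times
(`ae_ae_add_notMem`), and since the fields are Lipschitz, `γ + h` satisfies the equation of subunit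
paths up to an error `O(|h|)`.  This gives `|Λ_p(γ + h)'| ≤ C |Λ_p(γ + h)| + O(|h|)` at almost every
time.  Grönwall's inequality for locally Lipschitz curves (`norm_sub_le_of_ae_norm_deriv_le`) and the
limit `h → 0` along a dense set of translations yield the bound for `γ`
(`exists_norm_minorVector_sub_le`).  All constants are taken on a bounded neighbourhood of `Ω`, which
`γ` cannot leave in time `1 / C` (`norm_sub_lt_one_of_ae_norm_deriv_le`).

The wedge `Y_I` has the minors `Y_I^K` as coordinates in an orthonormal basis, so its increment is
bounded by that of `Λ_p` (`norm_wedge_sub_le`).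
-/

namespace LipDistribution

/-! ### Derivatives of determinants -/

section Determinant

open Matrix

variable {p : ℕ}

lemma sum_mul_adjugate_eq_det_updateRow (M : Matrix (Fin p) (Fin p) ℝ) (b : Fin p)
    (v : Fin p → ℝ) : ∑ a, v a * M.adjugate a b = (M.updateRow b v).det := by
  rw [← cramer_transpose_apply, cramer_eq_adjugate_mulVec, ← adjugate_transpose]
  simp [mulVec, dotProduct, mul_comm]

lemma sum_adjugate_mul_eq_det_updateCol (M : Matrix (Fin p) (Fin p) ℝ) (a : Fin p)
    (v : Fin p → ℝ) : ∑ b, M.adjugate a b * v b = (M.updateCol a v).det := by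
  rw [← cramer_apply, cramer_eq_adjugate_mulVec]
  simp [mulVec, dotProduct]

/-- Jacobi's formula `(det M)' = tr (adj M · M')`. -/
lemma hasDerivAt_det {M : ℝ → Matrix (Fin p) (Fin p) ℝ} {M' : Matrix (Fin p) (Fin p) ℝ} {t : ℝ}
    (h : ∀ b a, HasDerivAt (fun s => M s b a) (M' b a) t) :
    HasDerivAt (fun s => (M s).det) ((M t).adjugate * M').trace t := by
  let F : ContinuousMultilinearMap ℝ (fun _ : Fin p => Fin p → ℝ) ℝ :=
    ⟨(detRowAlternating (R := ℝ) (n := Fin p)).toMultilinearMap,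
      Continuous.matrix_det continuous_id⟩
  have hM : HasDerivAt (fun s => (M s : Fin p → Fin p → ℝ)) M' t :=
    hasDerivAt_pi.2 fun b => hasDerivAt_pi.2 fun a => h b a
  have key := (F.hasFDerivAt (M t)).comp_hasDerivAt t hM
  have e : F.linearDeriv (M t) M' = ((M t).adjugate * M').trace := by
    refine (F.linearDeriv_apply (M t) M').trans ?_
    rw [trace_mul_comm, trace]
    exact Finset.sum_congr rfl fun b _ => (sum_mul_adjugate_eq_det_updateRow (M t) b (M' b)).symm
  rw [← e]
  exact key

lemma contDiff_det {F : Type*} [NormedAddCommGroup F] [NormedSpace ℝ F]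
    {M : F → Matrix (Fin p) (Fin p) ℝ} (hM : ∀ b a, ContDiff ℝ 1 fun z => M z b a) :
    ContDiff ℝ 1 fun z => (M z).det := by
  simp only [det_apply]
  fun_prop

lemma abs_adjugate_le {M : Matrix (Fin p) (Fin p) ℝ} {B : ℝ} (hB : 1 ≤ B)
    (hM : ∀ b a, |M b a| ≤ B) (a b : Fin p) : |M.adjugate a b| ≤ p.factorial * B ^ p := by
  rw [adjugate_apply]
  have := det_le (A := M.updateRow b (Pi.single a 1)) (abv := IsAbsoluteValue.toAbsoluteValue abs)
    (x := B) (fun i j => ?_)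
  · simpa using this
  · simp only [IsAbsoluteValue.toAbsoluteValue_apply, updateRow_apply, Pi.single_apply]
    split_ifs
    · simpa using hB
    · simpa using zero_le_one.trans hB
    · exact hM i j

end Determinant

/-! ### Minors -/

variable {n q p : ℕ}

lemma abs_minor_le_norm_minorVector (Y : Fin q → E n → E n) (J : MultiIndex p q)
    (K : MultiIndex p n) (z : E n) : |minor Y J K z| ≤ ‖minorVector Y p z‖ :=
  PiLp.norm_apply_le (minorVector Y p z) (J, K)

lemma exists_perm_comp_eq_multiIndex {m : ℕ} {c : Fin p → Fin m} (hc : c.Injective) :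
    ∃ (σ : Equiv.Perm (Fin p)) (J : MultiIndex p m), ∀ a, c (σ a) = J a :=
  ⟨Tuple.sort c, OrderEmbedding.ofStrictMono (c ∘ Tuple.sort c)
    ((Tuple.monotone_sort c).strictMono_of_injective (hc.comp (Equiv.injective _))), fun _ => rfl⟩

/-- A determinant formed with arbitrary, possibly repeated or unordered, rows and columns is zero
or, up to sign, one of the minors `Y_J^K`. -/
lemma abs_det_le_norm_minorVector (Y : Fin q → E n → E n) (c : Fin p → Fin q) (r : Fin p → Fin n)
    (z : E n) :
    |(Matrix.of fun b a => Y (c a) z (r b)).det| ≤ ‖minorVector Y p z‖ := by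
  by_cases hc : c.Injective
  swap
  · simp only [Function.Injective, not_forall] at hc
    obtain ⟨a, a', haa, hne⟩ := hc
    rw [Matrix.det_zero_of_column_eq hne fun b => by simp [haa]]
    simp
  by_cases hr : r.Injective
  swap
  · simp only [Function.Injective, not_forall] at hr
    obtain ⟨b, b', hbb, hne⟩ := hr
    rw [Matrix.det_zero_of_row_eq hne (by ext; simp [hbb])]
    simp
  obtain ⟨σ, J, hJ⟩ := exists_perm_comp_eq_multiIndex hc
  obtain ⟨τ, K, hK⟩ := exists_perm_comp_eq_multiIndex hr
  have h := abs_minor_le_norm_minorVector Y J K z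
  have e : (Matrix.of fun b a => Y (J a) z (K b)) =
      ((Matrix.of fun b a => Y (c a) z (r b)).submatrix τ id).submatrix id σ := by
    ext b a
    simp [hJ, hK]
  rw [minor, e, Matrix.det_permute', Matrix.det_permute, abs_mul, abs_mul] at h
  have hs : ∀ π : Equiv.Perm (Fin p), |((Equiv.Perm.sign π : ℤ) : ℝ)| = 1 := fun π => by
    rcases Int.units_eq_one_or (Equiv.Perm.sign π) with h | h <;> simp [h]
  simpa [hs] using h

/-- The derivative of `Y_J^K` in a direction in which each `Yⱼ` has derivative `V j`, by Jacobi's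
formula. -/
noncomputable def minorDeriv (Y : Fin q → E n → E n) (J : MultiIndex p q) (K : MultiIndex p n)
    (z : E n) (V : Fin q → E n) : ℝ :=
  ((Matrix.of fun b a => Y (J a) z (K b)).adjugate * Matrix.of fun b a => V (J a) (K b)).trace

lemma minorDeriv_add (Y : Fin q → E n → E n) (J : MultiIndex p q) (K : MultiIndex p n)
    (z : E n) (V W : Fin q → E n) :
    minorDeriv Y J K z (V + W) = minorDeriv Y J K z V + minorDeriv Y J K z W := by
  rw [minorDeriv, minorDeriv, minorDeriv, ← Matrix.trace_add, ← Matrix.mul_add]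
  rfl

/-- A linear map acting on the fields combines rows of the matrix of coordinates, hence takes
minors to combinations of minors. -/
lemma abs_minorDeriv_clm_le (Y : Fin q → E n → E n) (J : MultiIndex p q) (K : MultiIndex p n)
    (z : E n) (A : E n →L[ℝ] E n) {α : ℝ} (hA : ‖A‖ ≤ α) :
    |minorDeriv Y J K z (fun j => A (Y j z))| ≤ p * n * α * ‖minorVector Y p z‖ := by
  have hAe : ∀ k m, |A (EuclideanSpace.single m 1) k| ≤ α := fun k m =>
    (PiLp.norm_apply_le (A (EuclideanSpace.single m 1)) k).trans <|
      (A.le_opNorm _).trans <| by simpa using hA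
  have hY : ∀ j k, A (Y j z) k = ∑ m, A (EuclideanSpace.single m 1) k * Y j z m := by
    intro j k
    have h : Y j z = ∑ m, Y j z m • EuclideanSpace.single m (1 : ℝ) := by
      ext i
      simp [Pi.single_apply]
    conv_lhs => rw [h]
    simp [mul_comm]
  have key : minorDeriv Y J K z (fun j => A (Y j z)) = ∑ b, ∑ m,
      A (EuclideanSpace.single m 1) (K b) *
        (Matrix.of fun b' a => Y (J a) z (Function.update (K : Fin p → Fin n) b m b')).det := by
    rw [minorDeriv, Matrix.trace_mul_comm, Matrix.trace]
    refine Finset.sum_congr rfl fun b _ => ?_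
    simp only [Matrix.diag_apply, Matrix.mul_apply, Matrix.of_apply, hY, Finset.sum_mul]
    rw [Finset.sum_comm]
    refine Finset.sum_congr rfl fun m _ => ?_
    simp only [mul_assoc]
    rw [← Finset.mul_sum, sum_mul_adjugate_eq_det_updateRow]
    congr 2
    ext b' a
    rcases eq_or_ne b' b with rfl | h <;> simp [*]
  rw [key]
  calc _ ≤ ∑ b : Fin p, ∑ m : Fin n, α * ‖minorVector Y p z‖ := by
        refine (Finset.abs_sum_le_sum_abs _ _).trans (Finset.sum_le_sum fun b _ =>
          (Finset.abs_sum_le_sum_abs _ _).trans (Finset.sum_le_sum fun m _ => ?_))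
        rw [abs_mul]
        exact mul_le_mul (hAe _ _) (abs_det_le_norm_minorVector Y _ _ z) (abs_nonneg _)
          ((norm_nonneg _).trans hA)
    _ = _ := by simp; ring

/-- Replacing the fields by linear combinations of the fields combines columns of the matrix of
coordinates. -/
lemma abs_minorDeriv_sum_le (Y : Fin q → E n → E n) (J : MultiIndex p q) (K : MultiIndex p n)
    (z : E n) (c : Fin q → Fin q → ℝ) {β : ℝ} (hc : ∀ j m, |c j m| ≤ β) :
    |minorDeriv Y J K z (fun j => ∑ m, c j m • Y m z)| ≤ p * q * β * ‖minorVector Y p z‖ := by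
  have key : minorDeriv Y J K z (fun j => ∑ m, c j m • Y m z) = ∑ a, ∑ m, c (J a) m *
        (Matrix.of fun b a' => Y (Function.update (J : Fin p → Fin q) a m a') z (K b)).det := by
    rw [minorDeriv, Matrix.trace]
    refine Finset.sum_congr rfl fun a _ => ?_
    simp only [Matrix.diag_apply, Matrix.mul_apply, Matrix.of_apply, WithLp.ofLp_sum,
      Finset.sum_apply, PiLp.smul_apply, smul_eq_mul, Finset.mul_sum]
    rw [Finset.sum_comm]
    refine Finset.sum_congr rfl fun m _ => ?_
    simp only [mul_left_comm _ (c (J a) m)]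
    rw [← Finset.mul_sum, sum_adjugate_mul_eq_det_updateCol]
    congr 2
    ext b a'
    rcases eq_or_ne a' a with rfl | h <;> simp [*]
  rw [key]
  calc _ ≤ ∑ a : Fin p, ∑ m : Fin q, β * ‖minorVector Y p z‖ := by
        refine (Finset.abs_sum_le_sum_abs _ _).trans (Finset.sum_le_sum fun b _ =>
          (Finset.abs_sum_le_sum_abs _ _).trans (Finset.sum_le_sum fun m _ => ?_))
        rw [abs_mul]
        exact mul_le_mul (hc _ _) (abs_det_le_norm_minorVector Y _ _ z) (abs_nonneg _)
          ((abs_nonneg _).trans (hc (J b) m))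
    _ = _ := by simp; ring

lemma abs_minorDeriv_le (Y : Fin q → E n → E n) (J : MultiIndex p q) (K : MultiIndex p n)
    (z : E n) (V : Fin q → E n) {B η : ℝ} (hB : 1 ≤ B) (hY : ∀ j, ‖Y j z‖ ≤ B)
    (hV : ∀ j, ‖V j‖ ≤ η) :
    |minorDeriv Y J K z V| ≤ p * p * (p.factorial * B ^ p) * η := by
  have h1 := abs_adjugate_le (M := Matrix.of fun b a => Y (J a) z (K b)) hB
    fun b a => (PiLp.norm_apply_le (Y (J a) z) (K b)).trans (hY _)
  calc _ ≤ ∑ a : Fin p, ∑ b : Fin p, (p.factorial * B ^ p) * η := by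
        rw [minorDeriv, Matrix.trace]
        simp only [Matrix.diag_apply, Matrix.mul_apply]
        refine (Finset.abs_sum_le_sum_abs _ _).trans (Finset.sum_le_sum fun a _ =>
          (Finset.abs_sum_le_sum_abs _ _).trans (Finset.sum_le_sum fun b _ => ?_))
        rw [abs_mul]
        exact mul_le_mul (h1 _ _) ((PiLp.norm_apply_le (V (J a)) (K b)).trans (hV _))
          (abs_nonneg _) (by positivity)
    _ = _ := by simp; ring

/-! ### Lipschitz curves with an almost everywhere bound on the derivative -/

section Curves

variable {F : Type*} [NormedAddCommGroup F] [InnerProductSpace ℝ F]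

/-- The fundamental theorem of calculus for absolutely continuous functions, applied to the
component of `f` along `f b - f a`. -/
lemma norm_sub_le_integral_of_ae_hasDerivAt {f : ℝ → F} (hf : LocallyLipschitz f) {a b : ℝ}
    (hab : a ≤ b) {g : ℝ → ℝ} (hg : Continuous g) (hg0 : ∀ s, 0 ≤ g s)
    (h : ∀ᵐ s, s ∈ Set.Ioo a b → ∃ f', HasDerivAt f f' s ∧ ‖f'‖ ≤ g s) :
    ‖f b - f a‖ ≤ ∫ s in a..b, g s := by
  set w := f b - f a with hw
  rcases (norm_nonneg w).eq_or_lt with h0 | h0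
  · rw [← h0]
    exact intervalIntegral.integral_nonneg hab fun s _ => hg0 s
  obtain ⟨K, hK⟩ := LocallyLipschitzOn.exists_lipschitzOnWith_of_compact
    (isCompact_uIcc (a := a) (b := b)) hf.locallyLipschitzOn
  have hφ : AbsolutelyContinuousOnInterval (fun s => inner ℝ w (f s)) a b :=
    ((innerSL ℝ w).lipschitz.comp_lipschitzOnWith hK).absolutelyContinuousOnInterval
  have hint := hφ.integral_deriv_eq_sub
  rw [← inner_sub_right, ← hw, real_inner_self_eq_norm_sq] at hint
  have hle : ∫ s in a..b, deriv (fun s => inner ℝ w (f s)) s ≤ ∫ s in a..b, ‖w‖ * g s := by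
    refine intervalIntegral.integral_mono_ae_restrict hab hφ.intervalIntegrable_deriv
      ((hg.const_mul _).intervalIntegrable _ _) ?_
    rw [← restrict_Ioo_eq_restrict_Icc]
    filter_upwards [ae_restrict_of_ae h, self_mem_ae_restrict measurableSet_Ioo] with s hs hsm
    obtain ⟨f', hf', hb⟩ := hs hsm
    have hd : HasDerivAt (fun s => inner ℝ w (f s)) (inner ℝ w f') s :=
      (innerSL ℝ w).hasFDerivAt.comp_hasDerivAt s hf'
    rw [hd.deriv]
    exact (real_inner_le_norm _ _).trans (by gcongr)
  rw [hint, intervalIntegral.integral_const_mul, sq] at hle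
  exact le_of_mul_le_mul_left hle h0

/-- Grönwall's inequality for a Lipschitz curve whose derivative is controlled almost
everywhere. -/
lemma norm_sub_le_of_ae_norm_deriv_le {f : ℝ → F} (hf : LocallyLipschitz f) {C δ b : ℝ}
    (hC : 0 < C) (hδ : 0 ≤ δ)
    (h : ∀ᵐ s, s ∈ Set.Ioo 0 b → ∃ f', HasDerivAt f f' s ∧ ‖f'‖ ≤ C * ‖f s‖ + δ)
    {t : ℝ} (ht : t ∈ Set.Icc 0 b) :
    ‖f t - f 0‖ ≤ (‖f 0‖ + δ / C) * (Real.exp (C * t) - 1) := by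
  have hfc : Continuous f := hf.continuous
  let g : ℝ → ℝ := fun s => C * ‖f s - f 0‖ + (C * ‖f 0‖ + δ)
  have hg : Continuous g := by fun_prop
  have hg0 : ∀ s, 0 ≤ g s := fun s => by positivity
  have hle : ∀ s ∈ Set.Icc 0 b, ‖f s - f 0‖ ≤ ∫ r in (0 : ℝ)..s, g r := by
    intro s hs
    refine norm_sub_le_integral_of_ae_hasDerivAt hf hs.1 hg hg0 ?_
    filter_upwards [h] with r hr hrs
    obtain ⟨f', hf', hb⟩ := hr ⟨hrs.1, hrs.2.trans_le hs.2⟩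
    refine ⟨f', hf', hb.trans ?_⟩
    have : ‖f r‖ ≤ ‖f r - f 0‖ + ‖f 0‖ := norm_le_norm_sub_add _ _
    simp only [g]
    nlinarith
  have hG : ∀ s, HasDerivAt (fun s => ∫ r in (0 : ℝ)..s, g r) (g s) s := fun s =>
    intervalIntegral.integral_hasDerivAt_right (hg.intervalIntegrable _ _)
      (hg.stronglyMeasurableAtFilter _ _) hg.continuousAt
  have hgr := norm_le_gronwallBound_of_norm_deriv_right_le (δ := 0) (K := C)
    (ε := C * ‖f 0‖ + δ) (a := 0) (b := b)
    (fun s _ => (hG s).continuousAt.continuousWithinAt) (fun s _ => (hG s).hasDerivWithinAt)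
    (by simp) (fun s hs => ?_) t ht
  · refine (hle t ht).trans ((le_abs_self _).trans (hgr.trans_eq ?_))
    rw [gronwallBound_of_K_ne_0 hC.ne']
    field_simp
    ring_nf
  · have h1 := hle s ⟨hs.1, hs.2.le⟩
    rw [Real.norm_of_nonneg (hg0 s)]
    have := h1.trans (le_abs_self _)
    simp only [g, Real.norm_eq_abs] at this ⊢
    nlinarith

/-- A curve whose speed is at most `D` as long as it stays in the open unit ball around its starting
point cannot leave that ball before time `1 / D`. -/
lemma norm_sub_lt_one_of_ae_norm_deriv_le {f : ℝ → F} (hf : LocallyLipschitz f) {D b : ℝ}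
    (hD : 0 ≤ D) (hDb : D * b < 1)
    (h : ∀ᵐ s, s ∈ Set.Ioo 0 b → ‖f s - f 0‖ < 1 → ∃ f', HasDerivAt f f' s ∧ ‖f'‖ ≤ D) :
    ∀ t ∈ Set.Icc 0 b, ‖f t - f 0‖ < 1 := by
  by_contra! hcon
  obtain ⟨t, ht, hft⟩ := hcon
  have hfc : Continuous f := hf.continuous
  have hclosed : IsClosed {s | 1 ≤ ‖f s - f 0‖} := isClosed_le (by fun_prop) (by fun_prop)
  -- `r` is the first exit time
  obtain ⟨r, ⟨hr, hr1⟩, hmin⟩ :=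
    (isCompact_Icc.inter_right hclosed).exists_isLeast ⟨t, ⟨ht, hft⟩⟩
  have hle := norm_sub_le_integral_of_ae_hasDerivAt hf hr.1 (continuous_const (y := D))
    (fun _ => hD) (by
      filter_upwards [h] with s hs hsr
      have hsb : s ∈ Set.Ioo 0 b := ⟨hsr.1, hsr.2.trans_le hr.2⟩
      exact hs hsb (not_le.1 fun hs1 =>
        (hmin ⟨Set.Ioo_subset_Icc_self hsb, hs1⟩).not_gt hsr.2))
  rw [intervalIntegral.integral_const, smul_eq_mul, sub_zero, mul_comm] at hle
  have : D * r ≤ D * b := mul_le_mul_of_nonneg_left hr.2 hD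
  have hr1' : 1 ≤ ‖f r - f 0‖ := hr1
  linarith

end Curves

/-! ### Generic translates -/

/-- By Fubini, almost every translate of a path spends almost no time in a null set. -/
lemma ae_ae_add_notMem {n : ℕ} {γ : ℝ → E n} (hγ : Continuous γ) {N : Set (E n)}
    (hN : volume N = 0) : ∀ᵐ h : E n, ∀ᵐ s : ℝ, γ s + h ∉ N := by
  have hmeas : MeasurableSet {x : ℝ × E n | γ x.1 + x.2 ∉ toMeasurable volume N} :=
    (measurableSet_toMeasurable _ _).compl.preimage (by fun_prop)
  have hprod : ∀ᵐ x : ℝ × E n ∂(volume.prod volume), γ x.1 + x.2 ∉ toMeasurable volume N := by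
    rw [Measure.ae_prod_iff_ae_ae hmeas]
    refine Filter.Eventually.of_forall fun s => ?_
    have := (measurePreserving_add_left (volume : Measure (E n)) (γ s)).quasiMeasurePreserving.ae
      (p := fun y => y ∉ toMeasurable volume N) (measure_eq_zero_iff_ae_notMem.1
        ((measure_toMeasurable N).trans hN))
    exact this
  filter_upwards [(Measure.ae_prod_iff_ae_ae (μ := (volume : Measure (E n)))
    (ν := (volume : Measure ℝ)) (p := fun x => γ x.2 + x.1 ∉ toMeasurable volume N)
    (hmeas.preimage measurable_swap)).1
    (Measure.measurePreserving_swap.quasiMeasurePreserving.ae hprod)] with h hh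
  filter_upwards [hh] with s hs hN'
  exact hs (subset_toMeasurable _ _ hN')

/-! ### The vector of minors along a curve -/

/-- The derivative of `Λ_p` in a direction in which each `Yⱼ` has derivative `V j`. -/
noncomputable def minorVectorDeriv (Y : Fin q → E n → E n) (p : ℕ) (z : E n) (V : Fin q → E n) :
    EuclideanSpace ℝ (MultiIndex p q × MultiIndex p n) :=
  WithLp.toLp 2 fun JK => minorDeriv Y JK.1 JK.2 z V

lemma hasDerivAt_minorVector {Y : Fin q → E n → E n} {σ : ℝ → E n} {w : E n} {t : ℝ}
    (hσ : HasDerivAt σ w t) (hY : ∀ j, DifferentiableAt ℝ (Y j) (σ t)) :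
    HasDerivAt (fun s => minorVector Y p (σ s))
      (minorVectorDeriv Y p (σ t) fun j => fderiv ℝ (Y j) (σ t) w) t := by
  have hpi : HasDerivAt (fun s => fun JK : MultiIndex p q × MultiIndex p n =>
      minor Y JK.1 JK.2 (σ s)) (fun JK => minorDeriv Y JK.1 JK.2 (σ t)
        fun j => fderiv ℝ (Y j) (σ t) w) t := by
    refine hasDerivAt_pi.2 fun JK => hasDerivAt_det fun b a => ?_
    have h := (hY (JK.1 a)).hasFDerivAt.comp_hasDerivAt t hσ
    exact (EuclideanSpace.proj (𝕜 := ℝ) (JK.2 b)).hasFDerivAt.comp_hasDerivAt t h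
  exact (PiLp.continuousLinearEquiv 2 ℝ
    fun _ : MultiIndex p q × MultiIndex p n => ℝ).symm.hasFDerivAt.comp_hasDerivAt t hpi

/-- `Λ_p` as a function of the values of the fields. -/
noncomputable def minorMap (n q p : ℕ) (Z : Fin q → E n) :
    EuclideanSpace ℝ (MultiIndex p q × MultiIndex p n) :=
  WithLp.toLp 2 fun JK => (Matrix.of fun b a => Z (JK.1 a) (JK.2 b)).det

lemma contDiff_minorMap : ContDiff ℝ 1 (minorMap n q p) := by
  refine (contDiff_piLp 2).2 fun JK => contDiff_det
    (M := fun Z : Fin q → E n => Matrix.of fun b a => Z (JK.1 a) (JK.2 b)) fun b a => ?_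
  simp only [Matrix.of_apply]
  fun_prop

lemma locallyLipschitz_pi {ι α : Type*} [Fintype ι] [PseudoEMetricSpace α] {X : ι → Type*}
    [∀ i, PseudoEMetricSpace (X i)]
    {f : α → ∀ i, X i} (hf : ∀ i, LocallyLipschitz fun x => f x i) : LocallyLipschitz f := by
  intro z
  choose K t ht hK using fun i => hf i z
  exact ⟨Finset.univ.sup K, ⋂ i, t i, Filter.iInter_mem.2 ht, fun x hx y hy =>
    edist_pi_le_iff.2 fun i => (hK i (Set.mem_iInter.1 hx i) (Set.mem_iInter.1 hy i)).trans
      (by gcongr; exact Finset.le_sup (Finset.mem_univ i))⟩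

lemma minorVector_eq_minorMap_comp (Y : Fin q → E n → E n) :
    minorVector Y p = minorMap n q p ∘ fun z j => Y j z := rfl

lemma locallyLipschitz_minorVector {Y : Fin q → E n → E n} (hY : ∀ j, LocallyLipschitz (Y j)) :
    LocallyLipschitz (minorVector Y p) := by
  rw [minorVector_eq_minorMap_comp]
  exact contDiff_minorMap.locallyLipschitz.comp (locallyLipschitz_pi hY)

/-- The differential inequality `|Λ_p'| ≤ C |Λ_p| + O(η)` for a curve with velocity `w` at the
point `z`, where `w` is within `η` of the horizontal vector `∑ₗ uₗ Yₗ(z)`.  Indeed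
`DYⱼ Yₗ = DYₗ Yⱼ + [Yₗ, Yⱼ]`: the first term is a linear map applied to `Yⱼ`, and the second one is
a combination of the fields. -/
lemma norm_minorVectorDeriv_le {Y : Fin q → E n → E n} {z w : E n} {u : E q} {L B C₀ η : ℝ}
    (hL : ∀ j, ‖fderiv ℝ (Y j) z‖ ≤ L) (hB : 1 ≤ B) (hY : ∀ j, ‖Y j z‖ ≤ B)
    (hbr : ∀ j k, VectorField.lieBracket ℝ (Y j) (Y k) z ∈ ballSpan Y C₀ z) (hu : ‖u‖ ≤ 1)
    (hw : ‖w - ∑ l, u l • Y l z‖ ≤ η) :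
    ‖minorVectorDeriv Y p z fun j => fderiv ℝ (Y j) z w‖ ≤
      Fintype.card (MultiIndex p q × MultiIndex p n) *
        ((p * n * (q * L) + p * q * (q * C₀)) * ‖minorVector Y p z‖ +
          p * p * (p.factorial * B ^ p) * (L * η)) := by
  choose c hc hbr using hbr
  have hul : ∀ l, |u l| ≤ 1 := fun l => (PiLp.norm_apply_le u l).trans hu
  set A : E n →L[ℝ] E n := ∑ l, u l • fderiv ℝ (Y l) z with hA
  have hAn : ‖A‖ ≤ q * L := by
    refine (norm_sum_le_of_le _ fun l _ => ?_).trans_eq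
      (show ∑ _l : Fin q, L = q * L by simp)
    rw [norm_smul]
    exact (mul_le_of_le_one_left (norm_nonneg _) (hul l)).trans (hL l)
  have hdec : (fun j => fderiv ℝ (Y j) z w) =
      (fun j => A (Y j z)) + (fun j => ∑ m, (∑ l, u l * c l j m) • Y m z) +
        fun j => fderiv ℝ (Y j) z (w - ∑ l, u l • Y l z) := by
    ext1 j
    have hl : ∀ l, fderiv ℝ (Y j) z (Y l z) =
        fderiv ℝ (Y l) z (Y j z) + ∑ m, c l j m • Y m z := fun l => by
      rw [← hbr l j, VectorField.lieBracket]
      abel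
    have hsw : ∑ m, (∑ l, u l * c l j m) • Y m z = ∑ l, u l • ∑ m, c l j m • Y m z := by
      simp only [Finset.sum_smul, Finset.smul_sum, smul_smul]
      exact Finset.sum_comm
    simp only [Pi.add_apply, hA, hsw, map_sub, map_sum, map_smul, hl, smul_add,
      Finset.sum_add_distrib, _root_.sum_apply, _root_.smul_apply]
    abel
  have hcomp : ∀ JK : MultiIndex p q × MultiIndex p n,
      ‖(minorVectorDeriv Y p z fun j => fderiv ℝ (Y j) z w) JK‖ ≤
        (p * n * (q * L) + p * q * (q * C₀)) * ‖minorVector Y p z‖ +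
          p * p * (p.factorial * B ^ p) * (L * η) := by
    intro JK
    have h1 := abs_minorDeriv_clm_le Y JK.1 JK.2 z A hAn
    have h2 := abs_minorDeriv_sum_le Y JK.1 JK.2 z (fun j m => ∑ l, u l * c l j m)
      (β := q * C₀) fun j m => by
        refine (Finset.abs_sum_le_sum_abs _ _).trans ((Finset.sum_le_sum fun l _ => ?_).trans_eq
          (show ∑ _l : Fin q, C₀ = q * C₀ by simp))
        rw [abs_mul]
        exact (mul_le_of_le_one_left (abs_nonneg _) (hul l)).trans
          ((PiLp.norm_apply_le (c l j) m).trans (hc l j))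
    have h3 := abs_minorDeriv_le Y JK.1 JK.2 z
      (fun j => fderiv ℝ (Y j) z (w - ∑ l, u l • Y l z)) (η := L * η) hB hY fun j =>
        (ContinuousLinearMap.le_opNorm _ _).trans
          (mul_le_mul (hL j) hw (norm_nonneg _) ((norm_nonneg _).trans (hL j)))
    change |minorDeriv Y JK.1 JK.2 z fun j => fderiv ℝ (Y j) z w| ≤ _
    rw [hdec, minorDeriv_add, minorDeriv_add]
    refine (abs_add_three _ _ _).trans ?_
    linarith
  calc ‖minorVectorDeriv Y p z fun j => fderiv ℝ (Y j) z w‖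
      ≤ ∑ JK, ‖(minorVectorDeriv Y p z fun j => fderiv ℝ (Y j) z w) JK‖ := by
        conv_lhs => rw [← (EuclideanSpace.basisFun (MultiIndex p q × MultiIndex p n) ℝ).sum_repr
          (minorVectorDeriv Y p z fun j => fderiv ℝ (Y j) z w)]
        refine (norm_sum_le _ _).trans_eq (Finset.sum_congr rfl fun JK _ => ?_)
        simp [norm_smul]
    _ ≤ ∑ _JK : MultiIndex p q × MultiIndex p n, _ := Finset.sum_le_sum fun JK _ => hcomp JK
    _ = _ := by rw [Finset.sum_const, nsmul_eq_mul, Finset.card_univ]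

/-! ### The exterior product and its coordinates -/

/-- The minors `Y_I^K` are the coordinates of `Y_I` in an orthonormal basis of `⋀ᵖ ℝⁿ`, and they
form a part of the vector `Λ_p`. -/
lemma norm_wedge_sub_le (Y : Fin q → E n → E n) (I : MultiIndex p q) (x y : E n) :
    ‖wedge Y I y - wedge Y I x‖ ≤ ‖minorVector Y p y - minorVector Y p x‖ := by
  let b := EuclideanSpace.basisFun (Fin n) ℝ
  have hcoord : ∀ (s : Set.powersetCard (Fin n) p) z, (b.exteriorPower p).repr (wedge Y I z) s =
      minor Y I (Set.powersetCard.ofFinEmbEquiv.symm s) z := by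
    intro s z
    rw [← OrthonormalBasis.coe_toBasis_repr_apply, OrthonormalBasis.toBasis_exteriorPower,
      exteriorPower.basis_repr_apply, wedge, exteriorPower.ιMultiDual_apply_ιMulti, minor,
      ← Matrix.det_transpose]
    rfl
  rw [← (b.exteriorPower p).repr.norm_map, EuclideanSpace.norm_eq, EuclideanSpace.norm_eq]
  refine Real.sqrt_le_sqrt ?_
  rw [Fintype.sum_prod_type]
  refine le_trans (le_of_eq ?_) (Finset.single_le_sum
    (f := fun J => ∑ K, ‖(minorVector Y p y - minorVector Y p x) (J, K)‖ ^ 2)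
    (fun J _ => by positivity) (Finset.mem_univ I))
  refine Fintype.sum_equiv Set.powersetCard.ofFinEmbEquiv.symm _ _ fun s => ?_
  rw [map_sub, PiLp.sub_apply, PiLp.sub_apply, hcoord, hcoord]
  rfl

/-! ### Subunit paths -/

/-- A subunit path is the restriction of a locally Lipschitz curve defined on all of `ℝ`. -/
lemma IsSubunit.exists_extension {Y : Fin q → E n → E n} {T : ℝ} {γ : ℝ → E n} (hT : 0 ≤ T)
    (h : IsSubunit Y T γ) : ∃ σ : ℝ → E n, LocallyLipschitz σ ∧ Set.EqOn σ γ (Set.Icc 0 T) ∧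
      ∃ u : ℝ → E q, ∀ᵐ s, s ∈ Set.Ioo 0 T →
        ‖u s‖ ≤ 1 ∧ HasDerivAt σ (∑ j, u s j • Y j (σ s)) s := by
  obtain ⟨⟨K, hK⟩, u, -, hu⟩ := h
  have heq : Set.EqOn (fun s => γ (Set.projIcc 0 T hT s)) γ (Set.Icc 0 T) := fun s hs => by
    simp [Set.projIcc_of_mem hT hs]
  refine ⟨fun s => γ (Set.projIcc 0 T hT s),
    (hK.to_restrict.comp (LipschitzWith.projIcc hT)).locallyLipschitz, heq, u, ?_⟩
  filter_upwards [(ae_restrict_iff' measurableSet_Ioo).1 hu] with s hs hsT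
  obtain ⟨hu1, hd⟩ := hs hsT
  refine ⟨hu1, ?_⟩
  rw [show γ (Set.projIcc 0 T hT s) = γ s from heq (Set.Ioo_subset_Icc_self hsT)]
  exact hd.congr_of_eventuallyEq
    (Filter.eventuallyEq_of_mem (Icc_mem_nhds hsT.1 hsT.2) heq)

lemma norm_sum_smul_le {F : Type*} [NormedAddCommGroup F] [NormedSpace ℝ F] {u : E q}
    (hu : ‖u‖ ≤ 1) {v : Fin q → F} {M : ℝ} (hv : ∀ j, ‖v j‖ ≤ M) :
    ‖∑ j, u j • v j‖ ≤ q * M := by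
  refine (norm_sum_le_of_le _ fun j _ => ?_).trans_eq (show ∑ _j : Fin q, M = q * M by simp)
  rw [norm_smul]
  exact (mul_le_of_le_one_left (norm_nonneg _) ((PiLp.norm_apply_le u j).trans hu)).trans (hv j)

/-- Almost every point of an open set on which the fields are Lipschitz is a point of
differentiability at which the brackets satisfy the involutivity condition. -/
lemma ae_differentiableAt_and_lieBracket_mem {Y : Fin q → E n → E n} {U : Set (E n)}
    (hU : IsOpen U) {L : NNReal} (hY : ∀ j, LipschitzOnWith L (Y j) U) {C₀ : ℝ}
    (hbr : ∀ j k : Fin q, ∀ᵐ x ∂(volume.restrict U),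
      VectorField.lieBracket ℝ (Y j) (Y k) x ∈ ballSpan Y C₀ x) :
    ∀ᵐ z, z ∈ U → (∀ j, DifferentiableAt ℝ (Y j) z) ∧
      ∀ j k, VectorField.lieBracket ℝ (Y j) (Y k) z ∈ ballSpan Y C₀ z := by
  have h1 := ae_all_iff.2 fun j => (hY j).ae_differentiableWithinAt_of_mem (μ := volume)
  have h2 := ae_all_iff.2 fun j => ae_all_iff.2 fun k =>
    (ae_restrict_iff' hU.measurableSet).1 (hbr j k)
  filter_upwards [h1, h2] with z hz1 hz2 hz
  exact ⟨fun j => (hz1 j hz).differentiableAt (hU.mem_nhds hz), fun j k => hz2 j k hz⟩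

/-- The estimate for a single `p`.  The path `γ` itself may run inside the null set where the
brackets are not controlled, but almost every translate `γ + h` meets that null set only for a null
set of times, and `γ + h` solves the equation of subunit paths up to an error `O(|h|)`. -/
lemma exists_norm_minorVector_sub_le {Y : Fin q → E n → E n} (hLip : ∀ j, LocallyLipschitz (Y j))
    (hInv : AEInvolutive Y) {Ω : Set (E n)} (hΩ : Bornology.IsBounded Ω) (p : ℕ) :
    ∃ C : ℝ, 0 < C ∧ ∀ x ∈ Ω, ∀ (T : ℝ) (γ : ℝ → E n), 0 ≤ T → IsSubunit Y T γ → γ 0 = x →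
      ∀ t ∈ Set.Icc (0 : ℝ) C⁻¹, t ≤ T →
        ‖minorVector Y p (γ t) - minorVector Y p x‖ ≤
          ‖minorVector Y p x‖ * (Real.exp (C * t) - 1) := by
  obtain ⟨R, hR⟩ := hΩ.subset_closedBall 0
  set U : Set (E n) := Metric.ball 0 (R + 2) with hUdef
  have hUK : U ⊆ Metric.closedBall 0 (R + 2) := Metric.ball_subset_closedBall
  have hKc : IsCompact (Metric.closedBall (0 : E n) (R + 2)) := isCompact_closedBall _ _
  obtain ⟨L, hL⟩ : ∃ L, ∀ j, LipschitzOnWith L (Y j) U := by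
    choose L hL using fun j => LocallyLipschitzOn.exists_lipschitzOnWith_of_compact hKc
      (hLip j).locallyLipschitzOn
    exact ⟨Finset.univ.sup L, fun j => ((hL j).mono hUK).weaken
      (Finset.le_sup (Finset.mem_univ j))⟩
  obtain ⟨B, hB1, hB⟩ : ∃ B : ℝ, 1 ≤ B ∧ ∀ j, ∀ z ∈ U, ‖Y j z‖ ≤ B := by
    choose B hB using fun j => hKc.exists_bound_of_continuousOn (hLip j).continuous.continuousOn
    refine ⟨1 + ∑ j, |B j|, le_add_of_nonneg_right (Finset.sum_nonneg fun j _ => abs_nonneg (B j)),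
      fun j z hz => ?_⟩
    have := Finset.single_le_sum (f := fun j => |B j|) (fun j _ => abs_nonneg (B j))
      (Finset.mem_univ j)
    linarith [hB j z (hUK hz), le_abs_self (B j)]
  obtain ⟨C₀, hC₀, hbr⟩ := hInv U Metric.isOpen_ball Metric.isBounded_ball
  have hgood := ae_differentiableAt_and_lieBracket_mem Metric.isOpen_ball hL hbr
  set N : ℝ := (Fintype.card (MultiIndex p q × MultiIndex p n) : ℝ)
  set C₁ : ℝ := N * (p * n * (q * L) + p * q * (q * C₀)) with hC₁
  set D : ℝ := N * (p * p * (p.factorial * B ^ p) * (L * (q * L))) with hD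
  have hC₁0 : 0 ≤ C₁ := by positivity
  have hD0 : 0 ≤ D := by positivity
  set C : ℝ := C₁ + q * B + 1 with hC
  have hqB : 0 ≤ q * B := by positivity
  have hC0 : 0 < C := by positivity
  refine ⟨C, hC0, fun x hx T γ hT hγ hγ0 t ht htT => ?_⟩
  obtain ⟨σ, hσ, hσγ, u, hu⟩ := hγ.exists_extension hT
  rw [← hγ0, ← hσγ ⟨ht.1, htT⟩, ← hσγ ⟨le_rfl, hT⟩]
  have hσ0 : ‖σ 0‖ ≤ R := by
    rw [hσγ ⟨le_rfl, hT⟩, hγ0]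
    simpa using hR hx
  have hu' : ∀ᵐ s, s ∈ Set.Ioo 0 t →
      ‖u s‖ ≤ 1 ∧ HasDerivAt σ (∑ j, u s j • Y j (σ s)) s := by
    filter_upwards [hu] with s hs hst
    exact hs ⟨hst.1, hst.2.trans_le htT⟩
  have hmem : ∀ s h, ‖σ s - σ 0‖ < 1 → ‖h‖ < 1 → σ s + h ∈ U := by
    intro s h hs hh
    rw [hUdef, mem_ball_zero_iff]
    calc ‖σ s + h‖ = ‖(σ s - σ 0) + σ 0 + h‖ := by rw [sub_add_cancel]
      _ ≤ ‖σ s - σ 0‖ + ‖σ 0‖ + ‖h‖ := norm_add₃_le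
      _ < R + 2 := by linarith
  have hqBt : q * B * t < 1 := by
    have h1 : C * t ≤ 1 := by
      calc C * t ≤ C * C⁻¹ := by gcongr; exact ht.2
        _ = 1 := mul_inv_cancel₀ hC0.ne'
    rcases ht.1.eq_or_lt with h0 | h0
    · rw [← h0, mul_zero]
      exact one_pos
    · have : q * B * t < C * t := mul_lt_mul_of_pos_right (by linarith) h0
      linarith
  -- On `[0, t]` the path stays in the unit ball around its starting point.
  have hconf := norm_sub_lt_one_of_ae_norm_deriv_le hσ hqB hqBt (by
    filter_upwards [hu'] with s hs hst hs1
    refine ⟨_, (hs hst).2, norm_sum_smul_le (hs hst).1 fun j => hB j _ ?_⟩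
    simpa using hmem s 0 hs1 (by simp))
  have hdense := Measure.dense_of_ae (ae_ae_add_notMem hσ.continuous hgood)
  have hbound : ∀ h ∈ Metric.ball (0 : E n) 1 ∩
      {h | ∀ᵐ s : ℝ, σ s + h ∉ {z | ¬ (z ∈ U → (∀ j, DifferentiableAt ℝ (Y j) z) ∧
        ∀ j k, VectorField.lieBracket ℝ (Y j) (Y k) z ∈ ballSpan Y C₀ z)}},
      ‖minorVector Y p (σ t + h) - minorVector Y p (σ 0 + h)‖ ≤
        (‖minorVector Y p (σ 0 + h)‖ + D * ‖h‖ / C) * (Real.exp (C * t) - 1) := by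
    rintro h ⟨hh1, hh⟩
    rw [mem_ball_zero_iff] at hh1
    have htrans : LocallyLipschitz fun s => σ s + h :=
      ((LipschitzWith.id.add (LipschitzWith.const h)).locallyLipschitz).comp hσ
    refine norm_sub_le_of_ae_norm_deriv_le (f := fun s => minorVector Y p (σ s + h))
      ((locallyLipschitz_minorVector hLip).comp htrans) hC0 (by positivity) ?_ ⟨ht.1, le_rfl⟩
    filter_upwards [hu', hh] with s hs hgs hst
    obtain ⟨hu1, hd⟩ := hs hst
    have hs1 := hconf s (Set.Ioo_subset_Icc_self hst)
    have hzU := hmem s h hs1 hh1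
    have hsU : σ s ∈ U := by simpa using hmem s 0 hs1 (by simp)
    obtain ⟨hdiff, hbrs⟩ := not_not.1 hgs hzU
    refine ⟨_, hasDerivAt_minorVector (hd.add_const h) hdiff, ?_⟩
    refine (norm_minorVectorDeriv_le (η := q * (L * ‖h‖)) (fun j =>
      norm_fderiv_le_of_lipschitzOn ℝ (Metric.isOpen_ball.mem_nhds hzU) (hL j)) hB1
      (fun j => hB j _ hzU) hbrs hu1 ?_).trans ?_
    · rw [← Finset.sum_sub_distrib]
      simp only [← smul_sub]
      refine norm_sum_smul_le hu1 fun j => ?_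
      simpa using (hL j).norm_sub_le hsU hzU
    · have e : N * ((p * n * (q * L) + p * q * (q * C₀)) * ‖minorVector Y p (σ s + h)‖ +
          p * p * (p.factorial * B ^ p) * (L * (q * (L * ‖h‖)))) =
          C₁ * ‖minorVector Y p (σ s + h)‖ + D * ‖h‖ := by
        rw [hC₁, hD]
        ring
      rw [e]
      gcongr
      linarith
  -- The estimate for the translates is a closed condition on `h`, and it holds on a dense subset of
  -- the unit ball, hence at `h = 0`.
  have hcont : Continuous (minorVector Y p) := (locallyLipschitz_minorVector hLip).continuous
  have hclosed : IsClosed {h : E n | ‖minorVector Y p (σ t + h) - minorVector Y p (σ 0 + h)‖ ≤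
      (‖minorVector Y p (σ 0 + h)‖ + D * ‖h‖ / C) * (Real.exp (C * t) - 1)} :=
    isClosed_le (by fun_prop) (by fun_prop)
  have h0 := hclosed.closure_subset_iff.2 hbound
    (hdense.open_subset_closure_inter Metric.isOpen_ball (Metric.mem_ball_self one_pos))
  simpa using h0

end LipDistribution

theorem theorem2p3 (n q : ℕ)
    (Y : Fin q → LipDistribution.E n → LipDistribution.E n)
    (hLip : ∀ j, LocallyLipschitz (Y j))
    (hInv : LipDistribution.AEInvolutive Y)
    (Ω : Set (LipDistribution.E n)) (hΩ : Bornology.IsBounded Ω) :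
    ∃ C : ℝ, 0 < C ∧
      ∀ x ∈ Ω, ∀ (T : ℝ) (γ : ℝ → LipDistribution.E n), 0 ≤ T →
        LipDistribution.IsSubunit Y T γ → γ 0 = x →
        (∀ p : ℕ, 1 ≤ p → p ≤ min q n → ∀ t ∈ Set.Icc (0 : ℝ) C⁻¹, t ≤ T →
          ‖LipDistribution.minorVector Y p (γ t) - LipDistribution.minorVector Y p x‖
            ≤ ‖LipDistribution.minorVector Y p x‖ * (Real.exp (C * t) - 1)) ∧
        (∀ p : ℕ, 1 ≤ p → p ≤ q → ∀ I : LipDistribution.MultiIndex p q,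
          ∀ t ∈ Set.Icc (0 : ℝ) C⁻¹, t ≤ T →
          ‖LipDistribution.wedge Y I (γ t) - LipDistribution.wedge Y I x‖
            ≤ C * ‖LipDistribution.minorVector Y p x‖ * (Real.exp (C * t) - 1)) := by
  choose C hC0 hC using LipDistribution.exists_norm_minorVector_sub_le hLip hInv hΩ
  -- The sum of the constants for all `p ≤ q` works for every such `p`: a larger constant shrinks the
  -- time interval and weakens the bound.  The extra `1` serves the factor `C` in the wedge estimate.
  have hle : ∀ p ≤ q, C p ≤ 1 + ∑ k ∈ Finset.range (q + 1), C k := fun p hp => by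
    have := Finset.single_le_sum (fun k _ => (hC0 k).le) (Finset.mem_range_succ_iff.2 hp)
    linarith
  set A : ℝ := 1 + ∑ k ∈ Finset.range (q + 1), C k with hA
  have hA1 : 1 ≤ A := by
    have := Finset.sum_nonneg fun k (_ : k ∈ Finset.range (q + 1)) => (hC0 k).le
    linarith
  have hmain : ∀ x ∈ Ω, ∀ (T : ℝ) (γ : ℝ → LipDistribution.E n), 0 ≤ T →
      LipDistribution.IsSubunit Y T γ → γ 0 = x → ∀ p ≤ q, ∀ t ∈ Set.Icc (0 : ℝ) A⁻¹, t ≤ T →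
      ‖LipDistribution.minorVector Y p (γ t) - LipDistribution.minorVector Y p x‖
        ≤ ‖LipDistribution.minorVector Y p x‖ * (Real.exp (A * t) - 1) := by
    intro x hx T γ hT hγ hγ0 p hp t ht htT
    have ht' : t ≤ (C p)⁻¹ := ht.2.trans (inv_anti₀ (hC0 p) (hle p hp))
    refine (hC p x hx T γ hT hγ hγ0 t ⟨ht.1, ht'⟩ htT).trans ?_
    have := ht.1
    gcongr
    exact hle p hp
  refine ⟨A, by linarith, fun x hx T γ hT hγ hγ0 =>
    ⟨fun p _ hp => hmain x hx T γ hT hγ hγ0 p (hp.trans (min_le_left _ _)),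
      fun p _ hp I t ht htT => (LipDistribution.norm_wedge_sub_le Y I x (γ t)).trans <|
        (hmain x hx T γ hT hγ hγ0 p hp t ht htT).trans ?_⟩⟩
  have hexp : 0 ≤ Real.exp (A * t) - 1 := by
    have := Real.one_le_exp (mul_nonneg (zero_le_one.trans hA1) ht.1)
    linarith
  gcongr
  exact le_mul_of_one_le_left (norm_nonneg _) hA1
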